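/- Let $G$ be a finite simple undirected graph with $n$ vertices and minimum degree $\delta(G)$. A set $D\subseteq V(G)$ is called $2$-dominating if every vertex of $G$ not in $D$ has at least two neighbors in $D$, and $\gamma_2(G)$ denotes the minimum cardinality of a $2$-dominating set of $G$. Then: (i) if $\delta(G)=6$, then $\gamma_2(G)\le \frac{456883}{918298}\,n<0.498\,n$; (ii) if $\delta(G)=7$, then $\gamma_2(G)\le \frac{140835095}{301690439}\,n<0.467\,n$; (iii) if $\delta(G)=8$, then $\gamma_2(G)\le \frac{292954593}{665571713}\,n<0.441\,n$; (iv) if $\delta(G)\ge 9$, then $\gamma_2(G)\le \frac{60805963517}{145812382205}\,n<0.418\,n$. -/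

import Mathlib

namespace SimpleGraph

/-- A finite set `D` of vertices is `k`-dominating in `G` if every vertex outside `D` has at least
`k` neighbors in `D`. -/
def IsKDominatingSet {V : Type*} (G : SimpleGraph V) [DecidableRel G.Adj] (k : ℕ)
    (D : Finset V) : Prop :=
  ∀ v : V, v ∉ D → k ≤ (D.filter (fun u => G.Adj v u)).card

/-- The `k`-domination number of a finite graph: the minimum cardinality of a `k`-dominating set.
The minimum is over a nonempty set of natural numbers, since the set of all vertices is
`k`-dominating. -/
noncomputable def kDominationNumber {V : Type*} [Fintype V] (G : SimpleGraph V)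
    [DecidableRel G.Adj] (k : ℕ) : ℕ :=
  sInf {m : ℕ | ∃ D : Finset V, G.IsKDominatingSet k D ∧ D.card = m}

theorem kDominationNumber_isLeast {V : Type*} [Fintype V] (G : SimpleGraph V)
    [DecidableRel G.Adj] (k : ℕ) :
    IsLeast {m : ℕ | ∃ D : Finset V, G.IsKDominatingSet k D ∧ D.card = m}
      (G.kDominationNumber k) :=
  ⟨Nat.sInf_mem ⟨_, Finset.univ, fun v hv => absurd (Finset.mem_univ v) hv, rfl⟩,
    fun _ hm => Nat.sInf_le hm⟩

end SimpleGraph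

/-! A 2-dominating set is built greedily and paid for by a potential. A vertex outside the current
set `D` has weight `f r t`, where `r` is its demand and `t` its load; for fixed `r` the weight is
nondecreasing, concave and eventually constant in `t`. At the start every demand is 2, so the
potential is at most `f 2 m` per vertex. If every selection lowers it by at least `S`, it ends
nonnegative and `S * γ₂ ≤ f 2 m * n`.

Selecting `v` removes the weight of `v`, lowers the demand of its needy neighbors, and thereby
lowers loads at distance up to two; concavity turns each lost unit of load into a guaranteed loss of
weight (`potential_insert_le`). Selection runs in phases. Caps bound the loads for each demand, and
a phase selects vertices of one demand whose load is the largest its cap allows; when none is left,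
that cap falls by one. The load of `v` is the sum of its neighbors' demands, so the required loss
can be shared among them in proportion to demand, which leaves a local inequality for each neighbor
(`potential_insert_of_stepOK`). Only finitely many such inequalities occur, and for explicit weights
they are decided by computation. -/

namespace TwoDomination

open Finset

/-! ### Loss of potential caused by selecting one vertex -/

section

variable {V : Type*} [DecidableEq V] (G : SimpleGraph V) [DecidableRel G.Adj]

/-- The number of further neighbors in `D` that `v` needs in order to be 2-dominated. -/
def demand (D : Finset V) (v : V) : ℕ :=
  if v ∈ D then 0 else 2 - #{u ∈ D | G.Adj v u}

variable [Fintype V] in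
/-- The total demand of the neighbors of `v`. -/
def load (D : Finset V) (v : V) : ℕ :=
  ∑ u, if G.Adj v u then demand G D u else 0

variable [Fintype V] in
/-- The total weight of the vertices outside `D`, where a vertex of demand `r` and load `t` has
weight `f r t`. -/
def potential (f : ℕ → ℕ → ℤ) (D : Finset V) : ℤ :=
  ∑ v, if v ∈ D then 0 else f (demand G D v) (load G D v)

/-- A lower bound for a sum over `D` terms, at most `n` of which are only at least `e`, while the
others are at least `c`. -/
def lowerSum (D n e c : ℕ) : ℕ := min D n * e + (D - n) * c

variable {G} {D : Finset V} {v : V}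

theorem demand_le_two (u : V) : demand G D u ≤ 2 := by
  unfold demand; split_ifs <;> omega

theorem demand_of_mem {u : V} (h : u ∈ D) : demand G D u = 0 := by
  simp [demand, h]

theorem notMem_of_demand_pos {u : V} (h : 1 ≤ demand G D u) : u ∉ D := fun hu => by
  simp [demand_of_mem hu] at h

theorem demand_insert (hv : v ∉ D) (u : V) :
    demand G D u = demand G (insert v D) u + (if u = v then demand G D v else 0) +
      (if G.Adj u v ∧ 1 ≤ demand G D u then 1 else 0) := by
  by_cases huv : u = v
  · subst huv
    simp [demand]
  · by_cases hu : u ∈ D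
    · simp [demand, hu, huv]
    · by_cases ha : G.Adj u v
      · have : #{w ∈ insert v D | G.Adj u w} = #{w ∈ D | G.Adj u w} + 1 := by
          rw [filter_insert, if_pos ha, card_insert_of_notMem (by simp [hv])]
        simp only [demand, mem_insert, hu, huv, or_self, if_false, this, ha, true_and]
        split_ifs <;> omega
      · have : #{w ∈ insert v D | G.Adj u w} = #{w ∈ D | G.Adj u w} := by
          rw [filter_insert, if_neg ha]
        simp [demand, hu, huv, this, ha]

variable [Fintype V]

/-- The number of neighbors of `u` whose demand decreases because they are adjacent to `v`. -/
def sharedCount (G : SimpleGraph V) [DecidableRel G.Adj] (D : Finset V) (v u : V) : ℕ :=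
  ∑ z, if G.Adj u z ∧ G.Adj z v ∧ 1 ≤ demand G D z then 1 else 0

theorem load_insert (hv : v ∉ D) (u : V) :
    load G D u = load G (insert v D) u + (if G.Adj u v then demand G D v else 0) +
      sharedCount G D v u := by
  have h2 : (if G.Adj u v then demand G D v else 0) =
      ∑ z, if z = v then (if G.Adj u z then demand G D v else 0) else 0 := by simp
  rw [h2, load, load, sharedCount, ← sum_add_distrib, ← sum_add_distrib]
  refine sum_congr rfl fun z _ => ?_
  by_cases h : G.Adj u z
  · simp only [h, if_true, true_and]
    exact demand_insert hv z
  · simp [h]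

/-- A vertex of demand `r ≥ 1` has exactly `2 - r` neighbors in `D`; all its other neighbors lie
outside. -/
theorem card_notMem_neighbors {d : ℕ} (hd : ∀ u, d ≤ G.degree u) {z : V}
    (hz : 1 ≤ demand G D z) :
    d + demand G D z ≤ #{u | G.Adj z u ∧ u ∉ D} + 2 := by
  have hzD := notMem_of_demand_pos hz
  have h1 : #{u | G.Adj z u ∧ u ∉ D} + #{u ∈ D | G.Adj z u} = G.degree z := by
    rw [← SimpleGraph.card_neighborFinset_eq_degree, ← card_union_of_disjoint]
    · congr 1; ext u; simp only [mem_union, mem_filter, mem_univ, true_and,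
        SimpleGraph.mem_neighborFinset]; tauto
    · rw [disjoint_left]; intro u; simp; tauto
  have := hd z
  simp only [demand, hzD, if_false] at hz ⊢
  omega

theorem card_demanding_neighbors_le (z : V) :
    #{u | G.Adj z u ∧ 1 ≤ demand G D u} ≤ load G D z := by
  rw [card_filter, load]
  refine sum_le_sum fun u _ => ?_
  by_cases h : G.Adj z u <;> simp only [h, true_and, false_and, if_true, if_false, le_refl]
  split_ifs <;> omega

theorem card_demanding_neighbors_erase_le {z : V} (h : G.Adj z v) :
    #{u | G.Adj z u ∧ 1 ≤ demand G D u ∧ u ≠ v} + demand G D v ≤ load G D z := by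
  have h2 : demand G D v = ∑ u, if u = v then demand G D v else 0 := by simp
  rw [card_filter, load, h2, ← sum_add_distrib]
  refine sum_le_sum fun u _ => ?_
  by_cases huv : u = v
  · subst huv; simp [h]
  · by_cases h : G.Adj z u <;> simp only [h, huv, true_and, false_and, if_true, if_false, add_zero, le_refl]
    split_ifs <;> omega

/-- Since `e ≤ c`, the worst case has as many cheap terms as allowed and no more terms than
required. -/
theorem lowerSum_le {D n e c : ℕ} (hec : e ≤ c) {a b : ℕ} (hab : D ≤ a + b) (ha : a ≤ n) :
    lowerSum D n e c ≤ a * e + b * c := by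
  unfold lowerSum
  rcases le_total D n with h | h
  · rw [min_eq_left h, Nat.sub_eq_zero_of_le h]
    nlinarith [Nat.mul_le_mul_left b hec, Nat.mul_le_mul_right e hab]
  · obtain ⟨x, rfl⟩ := Nat.exists_eq_add_of_le h
    obtain ⟨y, rfl⟩ := Nat.exists_eq_add_of_le ha
    rw [min_eq_right h, Nat.add_sub_cancel_left]
    have : y + x ≤ b := by omega
    nlinarith [Nat.mul_le_mul_right c this, Nat.mul_le_mul_left y hec]

/-- The guaranteed loss per unit of load of a vertex, depending on whether it has positive
demand. -/
def lossRate (e c r : ℕ) : ℕ := if r = 0 then c else e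

/-- Besides `v`, the vertex `z` has at least `d + r - 3` neighbors outside `D`, where `r` is its
demand. Those of positive demand each use at least one unit of the load of `z` not used by `v`, so
their number is bounded; the others lose at the rate `c`. -/
theorem lowerSum_le_sum_lossRate {d e c : ℕ} (hd : ∀ u, d ≤ G.degree u) (hec : e ≤ c)
    (hv : v ∉ D) {z : V} (hzv : G.Adj z v) (hz : 1 ≤ demand G D z) :
    lowerSum (d + demand G D z - 3) (load G D z - demand G D v) e c ≤
      ∑ u, if G.Adj z u ∧ u ∉ D ∧ u ≠ v then lossRate e c (demand G D u) else 0 := by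
  have h1 := card_notMem_neighbors hd hz
  have h2 := card_demanding_neighbors_erase_le (D := D) hzv
  have h3 : #{u | G.Adj z u ∧ u ∉ D} =
      #{u | G.Adj z u ∧ 1 ≤ demand G D u ∧ u ≠ v} +
        #{u | G.Adj z u ∧ demand G D u = 0 ∧ u ∉ D ∧ u ≠ v} + 1 := by
    rw [← card_union_of_disjoint, ← card_insert_of_notMem (a := v)]
    · congr 1; ext u
      simp only [mem_insert, mem_union, mem_filter, mem_univ, true_and]
      constructor
      · rintro ⟨ha, hu⟩
        by_cases huv : u = v
        · exact Or.inl huv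
        · rcases Nat.eq_zero_or_pos (demand G D u) with h | h
          · exact Or.inr (Or.inr ⟨ha, h, hu, huv⟩)
          · exact Or.inr (Or.inl ⟨ha, h, huv⟩)
      · rintro (rfl | ⟨ha, h, _⟩ | ⟨ha, _, h, _⟩)
        · exact ⟨hzv, hv⟩
        · exact ⟨ha, notMem_of_demand_pos h⟩
        · exact ⟨ha, h⟩
    · simp
    · rw [disjoint_left]; intro u; simp only [mem_filter, mem_univ, true_and]; omega
  refine (lowerSum_le hec (b := #{u | G.Adj z u ∧ demand G D u = 0 ∧ u ∉ D ∧ u ≠ v})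
    (by omega) (Nat.le_sub_of_add_le h2)).trans ?_
  rw [card_filter, card_filter, sum_mul, sum_mul, ← sum_add_distrib]
  refine sum_le_sum fun u _ => ?_
  by_cases h : 1 ≤ demand G D u
  · have hu := notMem_of_demand_pos h
    have h0 : demand G D u ≠ 0 := by omega
    by_cases ha : G.Adj z u ∧ u ≠ v <;> simp_all [lossRate]
  · have h0 : demand G D u = 0 := by omega
    by_cases ha : G.Adj z u ∧ u ∉ D ∧ u ≠ v <;> simp_all [lossRate]

/-- A lower bound for the loss of weight caused by the decreasing demand of `z`, a neighbor of
`v`, when `v` is added to `D`. -/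
def neighborGain (G : SimpleGraph V) [DecidableRel G.Adj] (f : ℕ → ℕ → ℤ) (d e c : ℕ)
    (D : Finset V) (v z : V) : ℤ :=
  f (demand G D z) (load G D z) - f (demand G D z - 1) (load G D z - demand G D v) +
    lowerSum (d + demand G D z - 3) (load G D z - demand G D v) e c

/-- `H0` and `H1` are the slope bounds. `H1` also covers the demand one lower, because a neighbor of
`v` first drops its demand and only then loses its remaining units of load. -/
theorem potential_insert_le {f : ℕ → ℕ → ℤ} {d e c : ℕ} (hd : ∀ u, d ≤ G.degree u) (hec : e ≤ c)
    (hv : v ∉ D)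
    (H0 : ∀ u, u ∉ D → demand G D u = 0 → ∀ x ≤ load G D u,
      f 0 (load G D u - x) + x * c ≤ f 0 (load G D u))
    (H1 : ∀ u, ∀ r, r = demand G D u ∨ r + 1 = demand G D u → 1 ≤ demand G D u →
      ∀ t ≤ load G D u, ∀ x ≤ t, f r (t - x) + x * e ≤ f r t) :
    f (demand G D v) (load G D v) +
        ((d + demand G D v - 2 - load G D v : ℕ) * demand G D v * c : ℤ) +
        ∑ z, (if G.Adj z v ∧ 1 ≤ demand G D z then neighborGain G f d e c D v z else 0) +
        potential G f (insert v D) ≤ potential G f D := by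
  -- `A u` is the loss caused directly by `v`; `K u` is the loss from load that disappears because
  -- neighbors shared with `v` need less.
  set A : V → ℤ := fun u => if u = v then f (demand G D v) (load G D v) else
    if G.Adj u v ∧ 1 ≤ demand G D u then
      f (demand G D u) (load G D u) - f (demand G D u - 1) (load G D u - demand G D v)
    else if G.Adj u v ∧ u ∉ D then (demand G D v * c : ℤ) else 0 with hA
  set K : V → ℤ := fun u => if u ∉ D ∧ u ≠ v then
    (sharedCount G D v u * lossRate e c (demand G D u) : ℕ) else 0 with hK
  have key : ∀ u, A u + K u + (if u ∈ insert v D then 0 else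
      f (demand G (insert v D) u) (load G (insert v D) u)) ≤
      if u ∈ D then 0 else f (demand G D u) (load G D u) := by
    intro u
    by_cases huv : u = v
    · subst huv; simp [hA, hK, hv]
    by_cases hu : u ∈ D
    · simp [hA, hK, hu, huv, demand_of_mem hu]
    have hl := load_insert (G := G) hv u
    have hr := demand_insert (G := G) hv u
    simp only [huv, if_false, add_zero] at hr
    simp only [hA, hK, hu, huv, mem_insert, or_self, if_false, not_false_eq_true, ne_eq,
      and_self, if_true, and_true]
    generalize sharedCount G D v u = x at *
    generalize load G (insert v D) u = t' at *
    rcases Nat.eq_zero_or_pos (demand G D u) with h0 | h0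
    · have h0' : demand G (insert v D) u = 0 := by omega
      have := H0 u hu h0 (load G D u - t') (Nat.sub_le _ _)
      rw [Nat.sub_sub_self (by omega)] at this
      simp only [h0, h0', lossRate, if_true, nonpos_iff_eq_zero, one_ne_zero, and_false, if_false]
      by_cases ha : G.Adj u v
      · simp only [ha, if_true] at hl ⊢
        have hx : load G D u - t' = demand G D v + x := by omega
        rw [hx] at this
        push_cast at this ⊢
        linarith
      · simp only [ha, if_false, add_zero] at hl ⊢
        have hx : load G D u - t' = x := by omega
        rw [hx] at this
        push_cast at this ⊢
        linarith
    · have hne : demand G D u ≠ 0 := by omega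
      by_cases ha : G.Adj u v
      · have hr' : demand G (insert v D) u = demand G D u - 1 := by
          have : G.Adj u v ∧ 1 ≤ demand G D u := ⟨ha, h0⟩
          rw [if_pos this] at hr; omega
        have := H1 u (demand G D u - 1) (Or.inr (by omega)) h0 (load G D u - demand G D v)
          (Nat.sub_le _ _) x (by simp only [ha, if_true] at hl; omega)
        have ht : load G D u - demand G D v - x = t' := by
          simp only [ha, if_true] at hl; omega
        rw [ht] at this
        have h1 : 1 ≤ demand G D u := h0
        simp only [ha, h1, hr', lossRate, hne, and_self, if_true, if_false]
        push_cast
        linarith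
      · simp only [ha, false_and, if_false, add_zero] at hr hl ⊢
        have := H1 u (demand G D u) (Or.inl rfl) h0 (load G D u) le_rfl x (by omega)
        have ht : load G D u - x = t' := by omega
        rw [ht] at this
        simp only [← hr, lossRate, hne, if_false]
        push_cast
        linarith
  have hsum := sum_le_sum fun u (_ : u ∈ (univ : Finset V)) => key u
  rw [sum_add_distrib, sum_add_distrib] at hsum
  change _ + potential G f (insert v D) ≤ potential G f D at hsum
  -- Double counting over the paths `v`, `z`, `u`: the loss at `u` is credited to the middle vertex
  -- `z`.
  have hKsum : ∑ z, (if G.Adj z v ∧ 1 ≤ demand G D z then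
      (lowerSum (d + demand G D z - 3) (load G D z - demand G D v) e c : ℤ) else 0) ≤ ∑ u, K u := by
    have h1 : ∑ u, K u = ((∑ z, if G.Adj z v ∧ 1 ≤ demand G D z then
        ∑ u, (if G.Adj z u ∧ u ∉ D ∧ u ≠ v then lossRate e c (demand G D u) else 0) else 0 : ℕ) :
          ℤ) := by
      have h2 : ∀ u, K u = ((∑ z, if G.Adj z v ∧ 1 ≤ demand G D z then
          (if G.Adj z u ∧ u ∉ D ∧ u ≠ v then lossRate e c (demand G D u) else 0) else 0 : ℕ) :
            ℤ) := by
        intro u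
        simp only [hK, sharedCount, sum_mul]
        by_cases h : u ∉ D ∧ u ≠ v
        · rw [if_pos h]
          congr 1
          refine sum_congr rfl fun z _ => ?_
          by_cases h1 : G.Adj z v ∧ 1 ≤ demand G D z <;> by_cases h3 : G.Adj u z <;>
            simp [h, h1, h3, G.adj_comm z u]
        · rw [if_neg h, eq_comm, Nat.cast_eq_zero]
          refine sum_eq_zero fun z _ => ?_
          have : ¬ (G.Adj z u ∧ u ∉ D ∧ u ≠ v) := fun h' => h h'.2
          simp [this]
      simp_rw [h2]
      rw [← Nat.cast_sum, sum_comm]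
      congr 1
      refine sum_congr rfl fun z _ => ?_
      split_ifs <;> simp
    rw [h1, Nat.cast_sum]
    refine sum_le_sum fun z _ => ?_
    split_ifs with h
    · exact_mod_cast lowerSum_le_sum_lossRate hd hec hv h.1 h.2
    · simp
  have hAsum : f (demand G D v) (load G D v) +
      ((d + demand G D v - 2 - load G D v : ℕ) * demand G D v * c : ℤ) +
      ∑ z, (if G.Adj z v ∧ 1 ≤ demand G D z then
        f (demand G D z) (load G D z) - f (demand G D z - 1) (load G D z - demand G D v) else 0)
      ≤ ∑ u, A u := by
    have h1 : ∀ u, A u = (if u = v then f (demand G D v) (load G D v) else 0) +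
        (if G.Adj v u ∧ demand G D u = 0 ∧ u ∉ D then 1 else 0) * (demand G D v * c : ℤ) +
        (if G.Adj u v ∧ 1 ≤ demand G D u then
          f (demand G D u) (load G D u) - f (demand G D u - 1) (load G D u - demand G D v)
          else 0) := by
      intro u
      simp only [hA]
      by_cases huv : u = v
      · subst huv; simp
      · by_cases ha : G.Adj u v
        · rcases Nat.eq_zero_or_pos (demand G D u) with h0 | h0
          · by_cases hu : u ∈ D <;> simp [huv, ha, ha.symm, h0, hu]
          · have h1 : 1 ≤ demand G D u := h0
            have h2 : demand G D u ≠ 0 := by omega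
            simp [huv, ha, h1, h2]
        · have hb : ¬ G.Adj v u := fun h => ha h.symm
          simp [huv, ha, hb]
    simp_rw [h1]
    rw [sum_add_distrib, sum_add_distrib, ← sum_mul]
    have h2 : ∑ u, (if u = v then f (demand G D v) (load G D v) else 0) =
        f (demand G D v) (load G D v) := by simp
    -- At most `load G D v` neighbors of `v` have positive demand; the remaining ones outside `D`
    -- have demand 0, and each loses `demand G D v` units of load.
    have h3 : ((d + demand G D v - 2 - load G D v : ℕ) * demand G D v : ℤ) ≤
        (∑ u, if G.Adj v u ∧ demand G D u = 0 ∧ u ∉ D then 1 else 0 : ℤ) * demand G D v := by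
      rcases Nat.eq_zero_or_pos (demand G D v) with h0 | h0
      · simp [h0]
      · refine mul_le_mul_of_nonneg_right ?_ (by positivity)
        have h5 := card_notMem_neighbors (D := D) hd h0
        have h6 := card_demanding_neighbors_le (G := G) (D := D) v
        have h7 : #{u | G.Adj v u ∧ u ∉ D} ≤ #{u | G.Adj v u ∧ 1 ≤ demand G D u} +
            #{u | G.Adj v u ∧ demand G D u = 0 ∧ u ∉ D} := by
          refine (card_le_card fun u => ?_).trans (card_union_le _ _)
          simp only [mem_union, mem_filter, mem_univ, true_and]
          rintro ⟨ha, hu⟩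
          rcases Nat.eq_zero_or_pos (demand G D u) with h | h
          · exact Or.inr ⟨ha, h, hu⟩
          · exact Or.inl ⟨ha, h⟩
        rw [sum_boole]
        exact_mod_cast (by omega : _ ≤ #{u | G.Adj v u ∧ demand G D u = 0 ∧ u ∉ D})
    have h4 := mul_le_mul_of_nonneg_right h3 (Nat.cast_nonneg (α := ℤ) c)
    rw [h2]
    linarith
  have hsplit : ∑ z, (if G.Adj z v ∧ 1 ≤ demand G D z then neighborGain G f d e c D v z else 0) =
      ∑ z, (if G.Adj z v ∧ 1 ≤ demand G D z then
        f (demand G D z) (load G D z) - f (demand G D z - 1) (load G D z - demand G D v) else 0) +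
      ∑ z, (if G.Adj z v ∧ 1 ≤ demand G D z then
      (lowerSum (d + demand G D z - 3) (load G D z - demand G D v) e c : ℤ) else 0) := by
    rw [← sum_add_distrib]
    refine sum_congr rfl fun z _ => ?_
    split_ifs <;> simp [neighborGain]
  linarith

end

/-! ### Concave weights and phased selection -/

section

/-- A nondecreasing, concave sequence that is constant from `m` on. -/
structure IsWeight (m : ℕ) (g : ℕ → ℕ) : Prop where
  const : ∀ t, m ≤ t → g t = g m
  mono_succ : ∀ t, g t ≤ g (t + 1)
  concave : ∀ t, g t + g (t + 2) ≤ 2 * g (t + 1)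

/-- The smallest decrease of `g` per unit on arguments less than `k`. -/
def dropRate (g : ℕ → ℕ) (k : ℕ) : ℕ := g (k - 1) - g (k - 2)

theorem IsWeight.monotone {m : ℕ} {g : ℕ → ℕ} (hg : IsWeight m g) : Monotone g :=
  monotone_nat_of_le_succ hg.mono_succ

theorem IsWeight.diff_le {m : ℕ} {g : ℕ → ℕ} (hg : IsWeight m g) (a n : ℕ) :
    g (a + n + 1) + g a ≤ g (a + 1) + g (a + n) := by
  induction n with
  | zero => simp
  | succ n ih =>
    have h1 := hg.concave (a + n)
    have h2 := hg.mono_succ (a + n)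
    rw [show a + (n + 1) + 1 = a + n + 2 by ring, show a + (n + 1) = a + n + 1 by ring]
    omega

theorem IsWeight.sub_add_mul_le_of_lt {m : ℕ} {g : ℕ → ℕ} (hg : IsWeight m g) {t k x : ℕ}
    (ht : t < k) (hx : x ≤ t) : g (t - x) + x * dropRate g k ≤ g t := by
  induction x with
  | zero => simp
  | succ x ih =>
    have h1 := ih (by omega)
    obtain ⟨n, hn⟩ : ∃ n, k - 2 = (t - (x + 1)) + n := ⟨_, (Nat.add_sub_of_le (by omega)).symm⟩
    have h2 := hg.diff_le (t - (x + 1)) n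
    have h3 : dropRate g k + g (t - (x + 1)) ≤ g (t - x) := by
      unfold dropRate
      rw [show k - 1 = t - (x + 1) + n + 1 by omega, hn]
      rw [show t - (x + 1) + 1 = t - x by omega] at h2
      have := hg.mono_succ (t - (x + 1) + n)
      omega
    rw [add_mul, one_mul]
    omega

/-- By concavity the last increment below `k` is the smallest. If `t` is not below `k`, then `k ≥ m
+ 2` and the rate is 0. -/
theorem IsWeight.sub_add_mul_le {m : ℕ} {g : ℕ → ℕ} (hg : IsWeight m g) {t k x : ℕ}
    (ht : min t (m + 1) < k) (hx : x ≤ t) : g (t - x) + x * dropRate g k ≤ g t := by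
  by_cases htk : t < k
  · exact hg.sub_add_mul_le_of_lt htk hx
  · have h0 : dropRate g k = 0 := by
      unfold dropRate
      rw [hg.const (k - 1) (by omega), hg.const (k - 2) (by omega), Nat.sub_self]
    rw [h0, mul_zero, add_zero]
    exact hg.monotone (Nat.sub_le _ _)

/-- The entry `k`, `j` or `i` according to the demand `0`, `1` or `2`. -/
def capOf (i j k r : ℕ) : ℕ := if r = 2 then i else if r = 1 then j else k

/-- The guaranteed loss per unit of load of any vertex outside the dominating set. -/
def minRate (f : ℕ → ℕ → ℕ) (i j k : ℕ) : ℕ :=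
  min (dropRate (f 0) k) (min (if 2 ≤ j then dropRate (f 1) j else dropRate (f 0) k)
    (if 2 ≤ i then dropRate (f 2) i else dropRate (f 0) k))

/-- The guaranteed loss of weight, apart from the vertices of positive demand in its neighborhood,
when a vertex of demand `r` and maximum load is selected. -/
def baseGain (f : ℕ → ℕ → ℕ) (d i j k r : ℕ) : ℕ :=
  f r (capOf i j k r - 1) + (d + r - 2 - (capOf i j k r - 1)) * r * dropRate (f 0) k

/-- The condition which ensures that the loss at a neighbor of demand `r` and load `s` is at least
its share of `S`, when a vertex of demand `q` and load `T` is selected. -/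
def NeighborOK (f : ℕ → ℕ → ℕ) (d S e c b T q r s : ℕ) : Prop :=
  f (r - 1) (s - q) ≤ f r s + lowerSum (d + r - 3) (s - q) e c ∧
    r * S + T * f (r - 1) (s - q) ≤
      T * (f r s + lowerSum (d + r - 3) (s - q) e c) + r * b

instance (f : ℕ → ℕ → ℕ) (d S e c b T q r s : ℕ) : Decidable (NeighborOK f d S e c b T q r s) :=
  inferInstanceAs (Decidable (_ ∧ _))

/-- If loads of vertices of demand `2`, `1`, `0` are less than `i`, `j`, `k`, respectively
(where loads greater than `m` are identified), then selecting a vertex of demand `q` and maximum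
load decreases the weight by at least `S`. -/
def StepOK (f : ℕ → ℕ → ℕ) (d m S i j k q : ℕ) : Prop :=
  q ≤ 2 ∧ 1 ≤ capOf i j k q ∧ i ≤ j ∧ j ≤ k ∧
    (capOf i j k q = 1 → S ≤ baseGain f d i j k q) ∧
    ∀ r < 3, 1 ≤ r → ∀ s < (if m + 2 ≤ capOf i j k r then m + 3 else capOf i j k r), q ≤ s →
      NeighborOK f d S (minRate f i j k) (dropRate (f 0) k) (baseGain f d i j k q)
        (capOf i j k q - 1) q r s

instance (f : ℕ → ℕ → ℕ) (d m S i j k q : ℕ) : Decidable (StepOK f d m S i j k q) :=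
  inferInstanceAs (Decidable (_ ∧ _))

/-- A sequence of selection rules, given by the demands of the selected vertices, such that every
selection decreases the weight by at least `S`. -/
def PathOK (f : ℕ → ℕ → ℕ) (d m S : ℕ) : List ℕ → ℕ → ℕ → ℕ → Prop
  | [], i, j, _ => i = 0 ∧ j = 0
  | q :: p, i, j, k => StepOK f d m S i j k q ∧
      PathOK f d m S p (if q = 2 then i - 1 else i) (if q = 1 then j - 1 else j)
        (if q = 0 then k - 1 else k)

instance PathOK.decidable (f : ℕ → ℕ → ℕ) (d m S : ℕ) :
    ∀ (p : List ℕ) (i j k : ℕ), Decidable (PathOK f d m S p i j k)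
  | [], i, j, _ => inferInstanceAs (Decidable (i = 0 ∧ j = 0))
  | q :: p, i, j, k =>
    haveI := PathOK.decidable f d m S p (if q = 2 then i - 1 else i) (if q = 1 then j - 1 else j)
        (if q = 0 then k - 1 else k)
    inferInstanceAs (Decidable (_ ∧ _))

/-- Every vertex outside `D` has its load bounded by the cap belonging to its demand. -/
def Bounded {V : Type*} [Fintype V] [DecidableEq V] (G : SimpleGraph V) [DecidableRel G.Adj]
    (m i j k : ℕ) (D : Finset V) : Prop :=
  ∀ u, u ∉ D → min (load G D u) (m + 1) < capOf i j k (demand G D u)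

theorem capOf_antitone {i j k r r' : ℕ} (hij : i ≤ j) (hjk : j ≤ k) (h : r' ≤ r) (hr : r ≤ 2) :
    capOf i j k r ≤ capOf i j k r' := by
  unfold capOf; split_ifs <;> omega

/-- A cap of at most 1 leaves no load to lose, so such a demand need not restrict the rate. -/
theorem minRate_le_dropRate {f : ℕ → ℕ → ℕ} {i j k r : ℕ} (hr : r ≤ 2)
    (h : 2 ≤ capOf i j k r) : minRate f i j k ≤ dropRate (f r) (capOf i j k r) := by
  interval_cases r
  · exact min_le_left _ _
  · have h : 2 ≤ j := h
    refine (min_le_right _ _).trans ((min_le_left _ _).trans ?_)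
    rw [if_pos h]; rfl
  · have h : 2 ≤ i := h
    refine (min_le_right _ _).trans ((min_le_right _ _).trans ?_)
    rw [if_pos h]; rfl

variable {V : Type*} [Fintype V] [DecidableEq V] {G : SimpleGraph V} [DecidableRel G.Adj]
  {D : Finset V} {v : V}

/-- Selection only lowers loads and demands, and a lower demand has a cap at least as large. -/
theorem Bounded.insert {m i j k : ℕ} (hij : i ≤ j) (hjk : j ≤ k) (h : Bounded G m i j k D)
    (hv : v ∉ D) : Bounded G m i j k (insert v D) := by
  intro u hu
  rw [mem_insert, not_or] at hu
  have h1 := h u hu.2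
  have h2 := demand_insert (G := G) hv u
  have h3 := load_insert (G := G) hv u
  have h4 := capOf_antitone hij hjk (r' := demand G (Insert.insert v D) u) (r := demand G D u)
    (by omega) (demand_le_two u)
  omega

/-- Reduces unbounded loads to a finite check. The cutoff is `m + 2` because subtracting `q ≤ 2`
must stay in the constant range. -/
theorem neighborOK_values_eq {f : ℕ → ℕ → ℕ} {d m e c q r : ℕ} (hf : ∀ r, IsWeight m (f r))
    (hdm : d ≤ m) (hq : q ≤ 2) (hr : r ≤ 2) (s : ℕ) :
    f (r - 1) (min s (m + 2) - q) = f (r - 1) (s - q) ∧ f r (min s (m + 2)) = f r s ∧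
      lowerSum (d + r - 3) (min s (m + 2) - q) e c = lowerSum (d + r - 3) (s - q) e c := by
  rcases le_total s (m + 2) with h | h
  · simp [min_eq_left h]
  · rw [min_eq_right h]
    refine ⟨?_, ?_, ?_⟩
    · rw [(hf _).const _ (by omega), (hf _).const (s - q) (by omega)]
    · rw [(hf _).const _ (by omega), (hf _).const s (by omega)]
    · unfold lowerSum
      rw [min_eq_left (a := d + r - 3) (by omega), min_eq_left (a := d + r - 3) (by omega),
        Nat.sub_eq_zero_of_le (n := d + r - 3) (by omega : _ ≤ m + 2 - q),
        Nat.sub_eq_zero_of_le (n := d + r - 3) (by omega : _ ≤ s - q)]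

theorem neighborGain_of_stepOK {f : ℕ → ℕ → ℕ} {d m S i j k : ℕ} (hf : ∀ r, IsWeight m (f r))
    (hdm : d ≤ m) (hb : Bounded G m i j k D) (hs : StepOK f d m S i j k (demand G D v))
    {z : V} (hzv : G.Adj z v) (hz : 1 ≤ demand G D z) :
    0 ≤ neighborGain G (fun r t => (f r t : ℤ)) d (minRate f i j k) (dropRate (f 0) k) D v z ∧
    (demand G D z : ℤ) * (S - baseGain f d i j k (demand G D v)) ≤
      (capOf i j k (demand G D v) - 1 : ℕ) *
        neighborGain G (fun r t => (f r t : ℤ)) d (minRate f i j k) (dropRate (f 0) k) D v z := by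
  have hq := demand_le_two (G := G) (D := D) v
  have hr := demand_le_two (G := G) (D := D) z
  have hzb := hb z (notMem_of_demand_pos hz)
  have hqs : demand G D v ≤ load G D z :=
    (Nat.le_add_left _ _).trans (card_demanding_neighbors_erase_le hzv)
  obtain ⟨-, -, -, -, -, H⟩ := hs
  have H' := H (demand G D z) (by omega) hz (min (load G D z) (m + 2))
    (by split_ifs <;> omega) (by
      rcases le_total (load G D z) (m + 2) with h | h
      · rwa [min_eq_left h]
      · rw [min_eq_right h]; omega)
  have heq := neighborOK_values_eq (e := minRate f i j k) (c := dropRate (f 0) k) hf hdm hq hr (load G D z)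
  unfold neighborGain
  rw [NeighborOK, heq.1, heq.2.1, heq.2.2] at H'
  obtain ⟨H1, H2⟩ := H'
  zify at H1 H2
  constructor
  · linarith
  · linarith

theorem potential_insert_of_stepOK {f : ℕ → ℕ → ℕ} {d m S i j k : ℕ}
    (hd : ∀ u, d ≤ G.degree u) (hf : ∀ r, IsWeight m (f r)) (hdm : d ≤ m)
    (hb : Bounded G m i j k D) (hs : StepOK f d m S i j k (demand G D v)) (hv : v ∉ D)
    (hmax : capOf i j k (demand G D v) ≤ min (load G D v) (m + 1) + 1) :
    S + potential G (fun r t => (f r t : ℤ)) (insert v D) ≤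
      potential G (fun r t => (f r t : ℤ)) D := by
  obtain ⟨hq, hcap, hij, hjk, hS, -⟩ := id hs
  have hvb := hb v hv
  set q := demand G D v with hqdef
  set T := capOf i j k q - 1 with hT
  have hTle : T ≤ load G D v := by omega
  have hbase : (f q (load G D v) : ℤ) +
      ((d + q - 2 - load G D v : ℕ) * q * (dropRate (f 0) k : ℕ) : ℤ) =
      baseGain f d i j k q := by
    -- Either the load is exactly `T`, or `T = m + 1`, where the weight is constant and both
    -- truncated differences vanish.
    have h1 : f q (load G D v) = f q T ∧ d + q - 2 - load G D v = d + q - 2 - T := by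
      rcases lt_or_ge (load G D v) (m + 1) with h | h
      · have : load G D v = T := by omega
        rw [this]; exact ⟨rfl, rfl⟩
      · refine ⟨?_, by omega⟩
        rw [(hf q).const _ (by omega), (hf q).const T (by omega)]
    rw [baseGain, h1.1, h1.2]
    push_cast
    rfl
  have hgain := potential_insert_le (G := G) (D := D) (v := v) (f := fun r t => (f r t : ℤ))
    (e := minRate f i j k) (c := dropRate (f 0) k) hd (min_le_left _ _) hv
    (by
      intro u hu h0 x hx
      have h1 := hb u hu
      rw [h0] at h1
      exact_mod_cast (hf 0).sub_add_mul_le h1 hx)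
    (by
      intro u r hr h0 t ht x hx
      have h2 := demand_le_two (G := G) (D := D) u
      have h1 := (hb u (notMem_of_demand_pos h0)).trans_le
        (capOf_antitone (r' := r) hij hjk (by omega) h2)
      rcases Nat.eq_zero_or_pos x with rfl | hx0
      · simp
      · have h3 := (hf r).sub_add_mul_le (t := t) (k := capOf i j k r) (by omega) hx
        have h4 := minRate_le_dropRate (f := f) (i := i) (j := j) (k := k) (r := r) (by omega)
          (by omega)
        exact_mod_cast (Nat.add_le_add_left (Nat.mul_le_mul_left x h4) _).trans h3)
  set g : V → ℤ := fun z => neighborGain G (fun r t => (f r t : ℤ)) d (minRate f i j k)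
    (dropRate (f 0) k) D v z with hg
  have hg0 : 0 ≤ ∑ z, (if G.Adj z v ∧ 1 ≤ demand G D z then g z else 0) := by
    refine sum_nonneg fun z _ => ?_
    split_ifs with h
    · exact (neighborGain_of_stepOK hf hdm hb hs h.1 h.2).1
    · exact le_rfl
  -- The load is expanded as a sum of demands, so that each neighbor pays its proportional share of
  -- the deficit.
  have hg1 : (load G D v : ℤ) * (S - baseGain f d i j k q) ≤
      T * ∑ z, (if G.Adj z v ∧ 1 ≤ demand G D z then g z else 0) := by
    rw [load, Nat.cast_sum, sum_mul, mul_sum]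
    refine sum_le_sum fun z _ => ?_
    by_cases ha : G.Adj z v
    · rcases Nat.eq_zero_or_pos (demand G D z) with h0 | h0
      · simp [h0]
      · have h1 : 1 ≤ demand G D z := h0
        simpa [ha, ha.symm, h1] using (neighborGain_of_stepOK hf hdm hb hs ha h1).2
    · have hb : ¬ G.Adj v z := fun h => ha h.symm
      simp [ha, hb]
  change (f q (load G D v) : ℤ) + _ + ∑ z, (if G.Adj z v ∧ 1 ≤ demand G D z then g z else 0) + _
    ≤ _ at hgain
  rw [hbase] at hgain
  have hfin : (S : ℤ) ≤ baseGain f d i j k q +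
      ∑ z, (if G.Adj z v ∧ 1 ≤ demand G D z then g z else 0) := by
    rcases le_or_gt S (baseGain f d i j k q) with h | h
    · have : (S : ℤ) ≤ baseGain f d i j k q := by exact_mod_cast h
      linarith
    · have hT0 : 0 < T := by
        rcases Nat.eq_zero_or_pos T with h0 | h0
        · have := hS (by omega); omega
        · exact h0
      have h' : (baseGain f d i j k q : ℤ) < S := by exact_mod_cast h
      have h1 : (T : ℤ) * (S - baseGain f d i j k q) ≤
          load G D v * (S - baseGain f d i j k q) :=
        mul_le_mul_of_nonneg_right (by exact_mod_cast hTle) (by linarith)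
      have h2 := le_of_mul_le_mul_left (h1.trans hg1) (by exact_mod_cast hT0)
      linarith
  linarith

/-- Each call either selects a vertex or lowers a cap and moves to the next phase. With the caps for
demands 2 and 1 at 0, no vertex outside `D` has positive demand. -/
theorem exists_isKDominatingSet_of_pathOK {f : ℕ → ℕ → ℕ} {d m S : ℕ}
    (hd : ∀ u, d ≤ G.degree u) (hf : ∀ r, IsWeight m (f r)) (hdm : d ≤ m) :
    ∀ (p : List ℕ) (i j k : ℕ), PathOK f d m S p i j k → ∀ D : Finset V, Bounded G m i j k D →
      ∃ D' : Finset V, G.IsKDominatingSet 2 D' ∧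
        (S * #D' : ℤ) ≤ S * #D + potential G (fun r t => (f r t : ℤ)) D
  | [], i, j, k, hp, D, hb => by
    obtain ⟨rfl, rfl⟩ := hp
    refine ⟨D, fun u hu => ?_, ?_⟩
    · have h1 := hb u hu
      have h2 : demand G D u = 0 := by
        have := demand_le_two (G := G) (D := D) u
        by_contra h3
        unfold capOf at h1
        split_ifs at h1 <;> omega
      simp only [demand, hu, if_false] at h2
      omega
    · have : 0 ≤ potential G (fun r t => (f r t : ℤ)) D :=
        sum_nonneg fun u _ => by split_ifs <;> positivity
      linarith
  | q :: p, i, j, k, hp, D, hb => by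
    obtain ⟨hs, hp'⟩ := id hp
    by_cases h : ∃ v, v ∉ D ∧ demand G D v = q ∧ capOf i j k q ≤ min (load G D v) (m + 1) + 1
    · obtain ⟨v, hv, rfl, hmax⟩ := h
      obtain ⟨D', h1, h2⟩ := exists_isKDominatingSet_of_pathOK hd hf hdm (demand G D v :: p) i j k
        hp (insert v D) (hb.insert hs.2.2.1 hs.2.2.2.1 hv)
      refine ⟨D', h1, h2.trans ?_⟩
      have h3 := potential_insert_of_stepOK hd hf hdm hb hs hv hmax
      rw [card_insert_of_notMem hv]
      push_cast
      linarith
    · push Not at h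
      refine exists_isKDominatingSet_of_pathOK hd hf hdm p _ _ _ hp' D fun u hu => ?_
      have h1 := hb u hu
      have h2 := demand_le_two (G := G) (D := D) u
      have h3 := hs.1
      by_cases hq : demand G D u = q
      · have h4 := h u hu hq
        rw [hq] at h1 ⊢
        unfold capOf at *
        split_ifs at * <;> omega
      · unfold capOf at *
        split_ifs at * <;> omega
termination_by p _ _ _ _ D => (p.length, #(univ \ D))
decreasing_by
  · apply Prod.Lex.right
    exact card_lt_card (ssubset_iff_of_subset (by intro x; simp) |>.2 ⟨v, by simp [hv], by simp⟩)
  · apply Prod.Lex.left; simp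

theorem kDominationNumber_le {f : ℕ → ℕ → ℕ} {d m S : ℕ} {p : List ℕ}
    (hd : d ≤ G.minDegree) (hf : ∀ r, IsWeight m (f r)) (hdm : d ≤ m)
    (hp : PathOK f d m S p (m + 2) (m + 2) (m + 2)) :
    S * G.kDominationNumber 2 ≤ f 2 m * Fintype.card V := by
  obtain ⟨D', h1, h2⟩ := exists_isKDominatingSet_of_pathOK (G := G)
    (fun u => hd.trans (G.minDegree_le_degree u)) hf hdm p _ _ _ hp ∅ (fun u _ => by
      unfold capOf; split_ifs <;> omega)
  have h3 : G.kDominationNumber 2 ≤ #D' := (G.kDominationNumber_isLeast 2).2 ⟨D', h1, rfl⟩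
  have h4 : potential G (fun r t => (f r t : ℤ)) ∅ ≤ f 2 m * Fintype.card V := by
    rw [potential, mul_comm, ← nsmul_eq_mul, ← Finset.card_univ (α := V)]
    refine sum_le_card_nsmul _ _ _ fun u _ => ?_
    have : demand G ∅ u = 2 := by simp [demand]
    rw [if_neg (notMem_empty u), this]
    have h5 : f 2 (load G ∅ u) ≤ f 2 (max m (load G ∅ u)) := (hf 2).monotone (le_max_right _ _)
    rw [(hf 2).const _ (le_max_left _ _)] at h5
    exact_mod_cast h5
  have h5 : (S * #D' : ℤ) ≤ f 2 m * Fintype.card V := by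
    simp only [card_empty, Nat.cast_zero, mul_zero, zero_add] at h2
    exact h2.trans h4
  have h6 : S * #D' ≤ f 2 m * Fintype.card V := by exact_mod_cast h5
  exact (Nat.mul_le_mul_left S h3).trans h6

end

/-! ### Explicit weights for minimum degrees 6, 7, 8 and 9 -/

section

/-- The sequence that starts with the entries of `l` and is constant from index `m` on. -/
def table (m : ℕ) (l : List ℕ) (t : ℕ) : ℕ := l.getD (min t m) 0

/-- The weights given by the lists for white (demand two), yellow and blue vertices. -/
def weights (m : ℕ) (a y b : List ℕ) (r : ℕ) : ℕ → ℕ :=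
  table m (if r = 2 then a else if r = 1 then y else b)

/-- A finite test for `IsWeight m (table m l)`. -/
def TableOK (m : ℕ) (l : List ℕ) : Prop :=
  ∀ t < m, table m l t ≤ table m l (t + 1) ∧
    table m l t + table m l (t + 2) ≤ 2 * table m l (t + 1)

instance (m : ℕ) (l : List ℕ) : Decidable (TableOK m l) :=
  inferInstanceAs (Decidable (∀ t < m, _ ∧ _))

theorem TableOK.isWeight {m : ℕ} {l : List ℕ} (h : TableOK m l) : IsWeight m (table m l) := by
  have hc : ∀ t, m ≤ t → table m l t = table m l m := fun t ht => by simp [table, ht]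
  refine ⟨hc, fun t => ?_, fun t => ?_⟩
  · rcases lt_or_ge t m with ht | ht
    · exact (h t ht).1
    · rw [hc t ht, hc (t + 1) (by omega)]
  · rcases lt_or_ge t m with ht | ht
    · exact (h t ht).2
    · rw [hc t ht, hc (t + 1) (by omega), hc (t + 2) (by omega)]; omega

theorem isWeight_weights {m : ℕ} {a y b : List ℕ} (h : TableOK m a ∧ TableOK m y ∧ TableOK m b)
    (r : ℕ) : IsWeight m (weights m a y b r) := by
  unfold weights
  split_ifs
  exacts [h.1.isWeight, h.2.1.isWeight, h.2.2.isWeight]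

variable {V : Type*} [Fintype V] {G : SimpleGraph V} [DecidableRel G.Adj]

theorem kDominationNumber_le_of_tables {d m S : ℕ} (a y b p : List ℕ) (hd : d ≤ G.minDegree)
    (hdm : d ≤ m) (hT : TableOK m a ∧ TableOK m y ∧ TableOK m b)
    (hp : PathOK (weights m a y b) d m S p (m + 2) (m + 2) (m + 2)) :
    S * G.kDominationNumber 2 ≤ weights m a y b 2 m * Fintype.card V := by
  classical
  exact kDominationNumber_le hd (isWeight_weights hT) hdm hp

/-- The first three lists are weights for demands 2, 1, 0, scaled by `S`; the last gives the demand
handled in each phase. The bound is the final entry of the first list. -/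
theorem kDominationNumber_le_of_six_le_minDegree (h : 6 ≤ G.minDegree) :
    100000 * G.kDominationNumber 2 ≤ 49571 * Fintype.card V :=
  kDominationNumber_le_of_tables (d := 6) (m := 13) (S := 100000)
    [42188, 43997, 45499, 47001, 47852, 48539, 49025, 49366, 49516, 49571, 49571, 49571,
      49571, 49571]
    [21266, 27678, 29906, 32134, 34362, 36590, 37635, 38624, 39475, 40325, 41053, 41780,
      42070, 42359]
    [0, 15757, 21343, 26165, 29078, 31410, 32912, 34203, 35053, 35903, 36479, 37037,
      37595, 38153]
    [2, 2, 2, 1, 2, 2, 1, 1, 0, 2, 2, 2, 0, 1, 1, 1, 0, 0, 2, 1, 0, 2, 1, 0, 0, 2, 1, 0,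
      0, 2, 1, 2, 1, 0, 2, 1, 0, 2, 1, 0, 1, 0, 1, 0]
    h (by norm_num) (by decide +kernel) (by decide +kernel)

theorem kDominationNumber_le_of_seven_le_minDegree (h : 7 ≤ G.minDegree) :
    100000 * G.kDominationNumber 2 ≤ 46404 * Fintype.card V :=
  kDominationNumber_le_of_tables (d := 7) (m := 13) (S := 100000)
    [39252, 41126, 42509, 43892, 44648, 45245, 45694, 46028, 46241, 46370, 46404, 46404,
      46404, 46404]
    [17926, 24417, 26502, 28587, 30672, 32732, 34069, 35218, 35878, 36429, 36916, 37402,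
      37888, 38374]
    [0, 13687, 18809, 23152, 25786, 27846, 29229, 30379, 31134, 31685, 32172, 32658,
      33144, 33630]
    [2, 2, 1, 2, 1, 2, 0, 2, 0, 2, 1, 0, 2, 1, 1, 2, 1, 2, 0, 0, 1, 0, 2, 1, 0, 2, 0, 1,
      0, 1, 2, 2, 0, 1, 2, 1, 0, 2, 1, 0, 1, 0, 1, 0]
    h (by norm_num) (by decide +kernel) (by decide +kernel)

theorem kDominationNumber_le_of_eight_le_minDegree (h : 8 ≤ G.minDegree) :
    100000 * G.kDominationNumber 2 ≤ 43821 * Fintype.card V :=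
  kDominationNumber_le_of_tables (d := 8) (m := 13) (S := 100000)
    [38363, 39729, 40795, 41607, 42280, 42778, 43182, 43473, 43653, 43778, 43821, 43821,
      43821, 43821]
    [16325, 21937, 23958, 25978, 27998, 30018, 31129, 32152, 32874, 33371, 33868, 34365,
      34862, 35359]
    [0, 11961, 16642, 20497, 22862, 24693, 26152, 27176, 27898, 28395, 28892, 29389,
      29886, 30383]
    [2, 2, 1, 2, 1, 2, 0, 2, 2, 0, 2, 1, 1, 0, 0, 1, 2, 1, 2, 0, 1, 0, 2, 1, 0, 2, 1, 0,
      2, 1, 0, 2, 1, 0, 2, 1, 0, 2, 1, 0, 1, 0, 1, 0]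
    h (by norm_num) (by decide +kernel) (by decide +kernel)

theorem kDominationNumber_le_of_nine_le_minDegree (h : 9 ≤ G.minDegree) :
    100000 * G.kDominationNumber 2 ≤ 41180 * Fintype.card V :=
  kDominationNumber_le_of_tables (d := 9) (m := 15) (S := 100000)
    [35227, 36487, 37484, 38352, 39038, 39718, 40159, 40521, 40782, 40978, 41111, 41173,
      41180, 41180, 41180, 41180]
    [13797, 19221, 21303, 23385, 25467, 27234, 28659, 29679, 30382, 30966, 31428, 31880,
      32332, 32784, 33236, 33469]
    [0, 10782, 15182, 18784, 21043, 22810, 24219, 25255, 25958, 26541, 27004, 27456,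
      27908, 28360, 28812, 29264]
    [2, 2, 2, 1, 2, 1, 0, 2, 1, 2, 0, 2, 1, 2, 0, 1, 0, 0, 1, 2, 1, 0, 2, 1, 0, 2, 0, 2,
      1, 1, 0, 2, 0, 1, 2, 1, 0, 2, 1, 0, 2, 0, 1, 2, 0, 1, 1, 0, 1, 0]
    h (by norm_num) (by decide +kernel) (by decide +kernel)

end

end TwoDomination

theorem mainTheorem2 {V : Type*} [Fintype V] (G : SimpleGraph V) [DecidableRel G.Adj]
    (n : ℕ) (hn : Fintype.card V = n) :
    (G.minDegree = 6 →
      (G.kDominationNumber 2 : ℝ) ≤ (456883 / 918298 : ℝ) * (n : ℝ) ∧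
        (456883 / 918298 : ℝ) * (n : ℝ) < (0.498 : ℝ) * (n : ℝ)) ∧
    (G.minDegree = 7 →
      (G.kDominationNumber 2 : ℝ) ≤ (140835095 / 301690439 : ℝ) * (n : ℝ) ∧
        (140835095 / 301690439 : ℝ) * (n : ℝ) < (0.467 : ℝ) * (n : ℝ)) ∧
    (G.minDegree = 8 →
      (G.kDominationNumber 2 : ℝ) ≤ (292954593 / 665571713 : ℝ) * (n : ℝ) ∧
        (292954593 / 665571713 : ℝ) * (n : ℝ) < (0.441 : ℝ) * (n : ℝ)) ∧
    (9 ≤ G.minDegree →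
      (G.kDominationNumber 2 : ℝ) ≤ (60805963517 / 145812382205 : ℝ) * (n : ℝ) ∧
        (60805963517 / 145812382205 : ℝ) * (n : ℝ) < (0.418 : ℝ) * (n : ℝ)) := by
  subst hn
  -- The strict inequalities need a vertex. The decimal bounds from the tables are slightly stronger
  -- than the stated fractions.
  have hpos : 1 ≤ G.minDegree → (0 : ℝ) < Fintype.card V := fun h => by
    rcases isEmpty_or_nonempty V with hV | hV
    · simp at h
    · exact_mod_cast Fintype.card_pos
  refine ⟨fun h => ?_, fun h => ?_, fun h => ?_, fun h => ?_⟩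
  · have h0 := hpos (by omega)
    have h1 : (100000 * G.kDominationNumber 2 : ℝ) ≤ 49571 * Fintype.card V := by
      exact_mod_cast TwoDomination.kDominationNumber_le_of_six_le_minDegree h.ge
    constructor <;> linarith
  · have h0 := hpos (by omega)
    have h1 : (100000 * G.kDominationNumber 2 : ℝ) ≤ 46404 * Fintype.card V := by
      exact_mod_cast TwoDomination.kDominationNumber_le_of_seven_le_minDegree h.ge
    constructor <;> linarith
  · have h0 := hpos (by omega)
    have h1 : (100000 * G.kDominationNumber 2 : ℝ) ≤ 43821 * Fintype.card V := by
      exact_mod_cast TwoDomination.kDominationNumber_le_of_eight_le_minDegree h.ge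
    constructor <;> linarith
  · have h0 := hpos (by omega)
    have h1 : (100000 * G.kDominationNumber 2 : ℝ) ≤ 41180 * Fintype.card V := by
      exact_mod_cast TwoDomination.kDominationNumber_le_of_nine_le_minDegree h
    constructor <;> linarith
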